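/- All lattices are non-empty. For a lattice $L$, let $\mathrm{Con}(L)$ be the set of its congruences, ordered by inclusion, with greatest element $\nabla_L = L\times L$; congruences different from $\nabla_L$ are called proper. Let $\mathrm{Spec}(L)$ be the set of prime congruences of $L$, that is, of the proper congruences $\phi$ such that, for all $\alpha,\beta\in\mathrm{Con}(L)$, $[\alpha,\beta]\subseteq\phi$ implies $\alpha\subseteq\phi$ or $\beta\subseteq\phi$, where $[\alpha,\beta]$ is the commutator of $\alpha$ and $\beta$, i.e. the least congruence $\delta$ of $L$ such that $\alpha$ centralizes $\beta$ modulo $\delta$: for every lattice term $t$, all tuples $a,b$ that are componentwise $\alpha$-related and all tuples $c,d$ that are componentwise $\beta$-related, $t(a,c)\mathrel{\delta}t(a,d)$ implies $t(b,c)\mathrel{\delta}t(b,d)$ (for lattices, $[\alpha,\beta]=\alpha\cap\beta$). Let $\mathrm{Max}(L)$ be the set of maximal elements of $\mathrm{Con}(L)\setminus\{\nabla_L\}$, and let $\mathrm{Con}_2(L)$ be the set of congruences of $L$ with exactly two classes. For a lattice $L$ with greatest element and a lattice $M$ with least element, the ordinal sum $L\oplus M$ is obtained by placing $M$ above $L$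 and identifying the greatest element of $L$ with the least element of $M$. A lattice is said to be obtained from a class of lattices through finite direct products and/or finite ordinal sums if it can be built, up to isomorphism, from members of that class by finitely many applications, in any order, of direct products of finitely many (at least one) lattices and ordinal sums of finitely many (at least one) lattices, whenever these ordinal sums are defined. **Proposition 6.11.** Let $L$ be a lattice. 1. If $L$ can be obtained through finite direct products and/or finite ordinal sums from chains and/or bounded distributive lattices, then $\mathrm{Spec}(L)=\mathrm{Max}(L)=\mathrm{Con}_2(L)$. 2. If $L$ can be obtained through finite direct products and/or finite ordinal sums from chains and/or bounded distributive lattices and/or finite modular lattices and/or relatively complemented lattices satisfying the ascending chain condition, then $\mathrm{Spec}(L)=\mathrm{Max}(L)$. 3. If $L$ can be obtained through finite direct products and/or finite ordinal sums from chains and/or bounded distributive lattices and/or the pentagon (the five-element lattice $\{0,a,b,c,1\}$ with $0<a<b<1$, $0<c<1$, and $c$ incomparable to $a$ and to $b$), then $\mathrm{Max}(L)=\mathrm{Con}_2(L)$. -/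

import Mathlib

universe u

/-! ### Congruences of a lattice, ordered by inclusion -/

namespace LatticeCon

variable {L : Type u} [Lattice L]

/-- Congruences are ordered by inclusion. -/
instance instPartialOrder : PartialOrder (LatticeCon L) where
  le α β := ∀ ⦃x y : L⦄, α.r x y → β.r x y
  le_refl _ _ _ h := h
  le_trans _ _ _ h₁ h₂ _ _ h := h₂ (h₁ h)
  le_antisymm α β h₁ h₂ := by
    obtain ⟨s, _, _⟩ := α
    obtain ⟨t, _, _⟩ := β
    have hst : s = t := Setoid.ext fun _ _ => ⟨fun h => h₁ h, fun h => h₂ h⟩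
    subst hst
    rfl

/-- The total congruence `∇`. -/
instance instTop : Top (LatticeCon L) where
  top := { toSetoid := ⊤, inf := fun _ _ => trivial, sup := fun _ _ => trivial }

end LatticeCon

/-! ### The commutator of two congruences (term condition) -/

/-- Terms in the language of lattices with variables from `ι`. -/
inductive LatticeTerm (ι : Type) : Type
  | var : ι → LatticeTerm ι
  | inf : LatticeTerm ι → LatticeTerm ι → LatticeTerm ι
  | sup : LatticeTerm ι → LatticeTerm ι → LatticeTerm ι

/-- The value of a lattice term under an assignment of the variables. -/
def LatticeTerm.eval {ι : Type} {L : Type u} [Lattice L] (v : ι → L) : LatticeTerm ι → L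
  | .var i => v i
  | .inf s t => s.eval v ⊓ t.eval v
  | .sup s t => s.eval v ⊔ t.eval v

namespace LatticeCon

variable {L : Type u} [Lattice L]

/-- `α` centralizes `β` modulo `δ`: for every term `t(x₁,…,xₘ,y₁,…,yₙ)`, all `α`-related tuples
`a, b` and all `β`-related tuples `c, d`, `t(a,c) δ t(a,d)` implies `t(b,c) δ t(b,d)`. -/
def Centralizes (α β δ : LatticeCon L) : Prop :=
  ∀ (m n : ℕ) (t : LatticeTerm (Fin m ⊕ Fin n)) (a b : Fin m → L) (c d : Fin n → L),
    (∀ i, α.r (a i) (b i)) → (∀ j, β.r (c j) (d j)) →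
    δ.r (t.eval (Sum.elim a c)) (t.eval (Sum.elim a d)) →
    δ.r (t.eval (Sum.elim b c)) (t.eval (Sum.elim b d))

/-- The commutator `[α, β]`: the smallest congruence `δ` such that `α` centralizes `β` modulo `δ`,
that is, the intersection of all such `δ`. -/
def commutator (α β : LatticeCon L) : LatticeCon L where
  r x y := ∀ δ : LatticeCon L, Centralizes α β δ → δ.r x y
  iseqv :=
    { refl := fun x δ _ => δ.refl x
      symm := fun h δ hδ => δ.symm (h δ hδ)
      trans := fun h₁ h₂ δ hδ => δ.trans (h₁ δ hδ) (h₂ δ hδ) }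
  inf h₁ h₂ δ hδ := δ.inf (h₁ δ hδ) (h₂ δ hδ)
  sup h₁ h₂ δ hδ := δ.sup (h₁ δ hδ) (h₂ δ hδ)

variable (L)

/-- `Spec(L)`, the prime congruences: the proper congruences `φ` such that `[α, β] ⊆ φ` implies
`α ⊆ φ` or `β ⊆ φ`. -/
def Spec : Set (LatticeCon L) :=
  {φ | φ ≠ ⊤ ∧ ∀ α β : LatticeCon L, commutator α β ≤ φ → α ≤ φ ∨ β ≤ φ}

/-- `Max(L)`, the maximal congruences: the maximal elements of the set of proper congruences. -/
def Max : Set (LatticeCon L) :=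
  {θ | Maximal (fun ψ : LatticeCon L => ψ ≠ ⊤) θ}

/-- `Con₂(L)`, the two-class congruences: those with exactly two classes. -/
def Con₂ : Set (LatticeCon L) :=
  {θ | Nat.card (Quotient θ.toSetoid) = 2}

end LatticeCon

/-! ### Ordinal sums -/

/-- The ordinal sum `L ⊕ M` of a lattice `L` with a greatest element and a lattice `M` with a least
element, where the greatest element of `L` is identified with the least element of `M` and every
element of `L` lies below every element of `M`. It is realized as the sublattice of `L × M` that
consists of the pairs `(x, ⊥)`, forming the copy of `L`, and the pairs `(⊤, y)`, forming the copy
of `M`; the common element is `(⊤, ⊥)`. -/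
def ordinalSum (L M : Type u) [Lattice L] [OrderTop L] [Lattice M] [OrderBot M] :
    Sublattice (L × M) where
  carrier := {p | p.1 = ⊤ ∨ p.2 = ⊥}
  supClosed' := by
    rintro ⟨a, b⟩ ha ⟨c, d⟩ hc
    rcases ha with rfl | rfl <;> rcases hc with rfl | rfl <;> simp
  infClosed' := by
    rintro ⟨a, b⟩ ha ⟨c, d⟩ hc
    rcases ha with rfl | rfl <;> rcases hc with rfl | rfl <;> simp

/-! ### Building blocks -/

/-- A (non-empty) chain. -/
def IsChainLattice (L : Type u) [Lattice L] : Prop :=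
  Nonempty L ∧ ∀ x y : L, x ≤ y ∨ y ≤ x

/-- A bounded distributive lattice. -/
def IsBoundedDistributive (L : Type u) [Lattice L] : Prop :=
  (∃ o : L, IsBot o) ∧ (∃ i : L, IsTop i) ∧ ∀ x y z : L, x ⊓ (y ⊔ z) = (x ⊓ y) ⊔ (x ⊓ z)

/-- A (non-empty) finite modular lattice. -/
def IsFiniteModular (L : Type u) [Lattice L] : Prop :=
  Nonempty L ∧ Finite L ∧ IsModularLattice L

/-- A (non-empty) relatively complemented lattice (in every interval `[a, b]`, every element has a
complement) with the ascending chain condition. -/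
def IsRelativelyComplementedACC (L : Type u) [Lattice L] : Prop :=
  Nonempty L ∧ (∀ a b x : L, a ≤ x → x ≤ b → ∃ y : L, x ⊓ y = a ∧ x ⊔ y = b) ∧ WellFoundedGT L

/-- The five-element pentagon as an ordered set: all pairs in `{0, 1} × {0, 1, 2}` except `(1, 1)`,
with the componentwise order. Hence `(0,0) < (0,1) < (0,2) < (1,2)` and `(0,0) < (1,0) < (1,2)`,
with `(1,0)` incomparable to `(0,1)` and to `(0,2)`. -/
abbrev PentagonOrder : Type := {p : Fin 2 × Fin 3 // p ≠ (1, 1)}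

/-- `L` is (isomorphic to) the pentagon. -/
def IsPentagon (L : Type u) [Lattice L] : Prop :=
  Nonempty (L ≃o PentagonOrder)

/-- The lattices that can be obtained through finite direct products and finite ordinal sums, in
any order and any number of times, from lattices that satisfy `P`; as usual, up to isomorphism.
Finite products and finite ordinal sums are iterated binary ones. -/
inductive ObtainedFrom (P : ∀ (L : Type u) [Lattice L], Prop) :
    ∀ (L : Type u) [Lattice L], Prop
  | block (L : Type u) [Lattice L] : P L → ObtainedFrom P L
  | prod (L M : Type u) [Lattice L] [Lattice M] :
      ObtainedFrom P L → ObtainedFrom P M → ObtainedFrom P (L × M)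
  | ordinalSum (L M : Type u) [Lattice L] [OrderTop L] [Lattice M] [OrderBot M] :
      ObtainedFrom P L → ObtainedFrom P M → ObtainedFrom P (ordinalSum L M)
  | iso (L M : Type u) [Lattice L] [Lattice M] :
      L ≃o M → ObtainedFrom P L → ObtainedFrom P M

/-! For lattices `[α, β] = α ∩ β`, so a prime congruence is a meet-prime one. Always `Con₂ L ⊆ Max L
⊆ Spec L`, the second inclusion because congruence lattices of lattices are distributive. Each claim
therefore reduces to one reverse inclusion.

Each reverse inclusion is inherited by a subdirect product of two lattices: the two kernels meet in
equality, so a prime congruence contains one of them and is pulled back from a factor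
(`exists_eq_comap_of_mem_Spec`). Direct products, ordinal sums and isomorphic copies are all
subdirect products, so only the building blocks remain.

Modulo a prime congruence of a distributive lattice every element is a top or a bottom. For modular
and relatively complemented lattices, the intervals on which `θ` is contained in a prime `φ`
generate a kind of pseudocomplement of `θ`, and chain conditions prevent `φ < θ < ⊤`. In the
pentagon every nontrivial congruence collapses `a` and `b`, and the quotient by this collapse embeds
in a square of two-element chains. -/

namespace LatticeCon

section Basic

variable {L : Type*} [Lattice L] (θ : LatticeCon L)

theorem sup_congr_left {x y : L} (z : L) (h : θ.r x y) : θ.r (z ⊔ x) (z ⊔ y) :=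
  θ.sup (θ.refl z) h

theorem sup_congr_right {x y : L} (z : L) (h : θ.r x y) : θ.r (x ⊔ z) (y ⊔ z) :=
  θ.sup h (θ.refl z)

theorem inf_congr_left {x y : L} (z : L) (h : θ.r x y) : θ.r (z ⊓ x) (z ⊓ y) :=
  θ.inf (θ.refl z) h

theorem inf_congr_right {x y : L} (z : L) (h : θ.r x y) : θ.r (x ⊓ z) (y ⊓ z) :=
  θ.inf h (θ.refl z)

variable {θ}

theorem ne_top_iff : θ ≠ ⊤ ↔ ∃ x y, ¬ θ.r x y := by
  constructor
  · intro h
    by_contra! hc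
    exact h (le_antisymm (fun _ _ _ => trivial) fun x y _ => hc x y)
  · rintro ⟨x, y, h⟩ rfl
    exact h trivial

theorem r_of_eq_top (h : θ = ⊤) (x y : L) : θ.r x y := by
  subst h
  trivial

theorem le_of_forall_le {φ ψ : LatticeCon L} (h : ∀ x y, x ≤ y → φ.r x y → ψ.r x y) : φ ≤ ψ :=
  fun _ _ hxy => ψ.r_inf_sup_iff.1 (h _ _ inf_le_sup (φ.r_inf_sup_iff.2 hxy))

end Basic

/-! ### The commutator is the intersection. -/

section Commutator

variable {L : Type*} [Lattice L]

theorem eval_congr (θ : LatticeCon L) {ι : Type} {v w : ι → L} (h : ∀ i, θ.r (v i) (w i))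
    (t : LatticeTerm ι) : θ.r (t.eval v) (t.eval w) := by
  induction t with
  | var i => exact h i
  | inf s t hs ht => exact θ.inf hs ht
  | sup s t hs ht => exact θ.sup hs ht

/-- The intersection of two congruences. -/
def inter (α β : LatticeCon L) : LatticeCon L where
  toSetoid := α.toSetoid ⊓ β.toSetoid
  inf h₁ h₂ := ⟨α.inf h₁.1 h₂.1, β.inf h₁.2 h₂.2⟩
  sup h₁ h₂ := ⟨α.sup h₁.1 h₂.1, β.sup h₁.2 h₂.2⟩

theorem centralizes_inter (α β : LatticeCon L) : Centralizes α β (inter α β) := by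
  intro m n t a b c d hab hcd h
  have key : ∀ e : Fin n → L, α.r (t.eval (Sum.elim a e)) (t.eval (Sum.elim b e)) := fun e =>
    α.eval_congr (by rintro (i | j); exacts [hab i, α.refl _]) t
  refine ⟨α.trans (α.symm (key c)) (α.trans h.1 (key d)), ?_⟩
  exact β.eval_congr (by rintro (i | j); exacts [β.refl _, hcd j]) t

theorem Centralizes.inter_le {α β δ : LatticeCon L} (h : Centralizes α β δ) :
    inter α β ≤ δ := by
  refine le_of_forall_le fun x y hxy hr => ?_
  -- For `x ≤ y` the term `s ⊓ t` takes the value `x` at `(x, x)` and `(x, y)`, but `x` at `(y, x)`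
  -- and `y` at `(y, y)`.
  have := h 1 1 (.inf (.var (.inl 0)) (.var (.inr 0))) (fun _ => x) (fun _ => y) (fun _ => x)
    (fun _ => y) (fun _ => hr.1) (fun _ => hr.2)
  simpa [LatticeTerm.eval, hxy, δ.refl] using this

theorem commutator_eq_inter (α β : LatticeCon L) : commutator α β = inter α β :=
  le_antisymm (fun _ _ h => h _ (centralizes_inter α β)) fun _ _ h _ hδ => hδ.inter_le h

theorem mem_Spec_iff {φ : LatticeCon L} :
    φ ∈ Spec L ↔ φ ≠ ⊤ ∧ ∀ α β : LatticeCon L,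
      (∀ x y, α.r x y → β.r x y → φ.r x y) → α ≤ φ ∨ β ≤ φ := by
  simp only [Spec, Set.mem_ofPred_eq, commutator_eq_inter]
  exact ⟨fun h => ⟨h.1, fun α β H => h.2 α β fun x y hxy => H x y hxy.1 hxy.2⟩,
    fun h => ⟨h.1, fun α β H => h.2 α β fun x y h₁ h₂ => H ⟨h₁, h₂⟩⟩⟩

end Commutator

/-! ### The inclusions valid in every lattice. -/

section Inclusions

variable {L : Type*} [Lattice L]

theorem mem_Con₂_iff {θ : LatticeCon L} :
    θ ∈ Con₂ L ↔ ∃ a b, ¬ θ.r a b ∧ ∀ x, θ.r x a ∨ θ.r x b := by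
  rw [Con₂, Set.mem_ofPred_eq, Nat.card_eq_two_iff]
  constructor
  · rintro ⟨a, b, hab, h⟩
    induction a using Quotient.inductionOn with | h a => ?_
    induction b using Quotient.inductionOn with | h b => ?_
    refine ⟨a, b, fun hr => hab (Quotient.sound hr), fun x => ?_⟩
    have hx : (Quotient.mk _ x : Quotient θ.toSetoid) ∈ ({⟦a⟧, ⟦b⟧} : Set _) := h ▸ Set.mem_univ _
    exact hx.imp Quotient.exact Quotient.exact
  · rintro ⟨a, b, hab, h⟩
    refine ⟨⟦a⟧, ⟦b⟧, fun hr => hab (Quotient.exact hr), Set.eq_univ_of_forall fun x => ?_⟩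
    induction x using Quotient.inductionOn with | h x => ?_
    exact (h x).imp (fun h => Quotient.sound h) (fun h => Quotient.sound h)

theorem Con₂_subset_Max : Con₂ L ⊆ Max L := by
  intro θ hθ
  obtain ⟨a, b, hab, h⟩ := mem_Con₂_iff.1 hθ
  refine ⟨ne_top_iff.2 ⟨a, b, hab⟩, fun ψ hψ hle x y hxy => ?_⟩
  by_contra hn
  have hψab : ψ.r a b := by
    rcases h x with hx | hx <;> rcases h y with hy | hy
    · exact absurd (θ.trans hx (θ.symm hy)) hn
    · exact ψ.trans (ψ.symm (hle hx)) (ψ.trans hxy (hle hy))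
    · exact ψ.trans (ψ.symm (hle hy)) (ψ.trans (ψ.symm hxy) (hle hx))
    · exact absurd (θ.trans hx (θ.symm hy)) hn
  obtain ⟨p, q, hpq⟩ := ne_top_iff.1 hψ
  refine hpq ?_
  have key : ∀ z, ψ.r z a := fun z =>
    (h z).elim (fun hz => hle hz) fun hz => ψ.trans (hle hz) (ψ.symm hψab)
  exact ψ.trans (key p) (ψ.symm (key q))

/-- The join of two congruences. -/
def join (α β : LatticeCon L) : LatticeCon L where
  toSetoid := Relation.EqvGen.setoid fun x y => α.r x y ∨ β.r x y
  inf {w x y z} h₁ h₂ := by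
    refine Relation.EqvGen.trans _ (x ⊓ y) _ ?_ ?_
    · induction h₁ with
      | rel _ _ h => exact .rel _ _ (h.imp (α.inf_congr_right y) (β.inf_congr_right y))
      | refl => exact .refl _
      | symm _ _ _ ih => exact ih.symm
      | trans _ _ _ _ _ ih₁ ih₂ => exact ih₁.trans _ _ _ ih₂
    · induction h₂ with
      | rel _ _ h => exact .rel _ _ (h.imp (α.inf_congr_left x) (β.inf_congr_left x))
      | refl => exact .refl _
      | symm _ _ _ ih => exact ih.symm
      | trans _ _ _ _ _ ih₁ ih₂ => exact ih₁.trans _ _ _ ih₂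
  sup {w x y z} h₁ h₂ := by
    refine Relation.EqvGen.trans _ (x ⊔ y) _ ?_ ?_
    · induction h₁ with
      | rel _ _ h => exact .rel _ _ (h.imp (α.sup_congr_right y) (β.sup_congr_right y))
      | refl => exact .refl _
      | symm _ _ _ ih => exact ih.symm
      | trans _ _ _ _ _ ih₁ ih₂ => exact ih₁.trans _ _ _ ih₂
    · induction h₂ with
      | rel _ _ h => exact .rel _ _ (h.imp (α.sup_congr_left x) (β.sup_congr_left x))
      | refl => exact .refl _
      | symm _ _ _ ih => exact ih.symm
      | trans _ _ _ _ _ ih₁ ih₂ => exact ih₁.trans _ _ _ ih₂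

theorem le_join_left (α β : LatticeCon L) : α ≤ join α β := fun _ _ h => .rel _ _ (.inl h)

theorem le_join_right (α β : LatticeCon L) : β ≤ join α β := fun _ _ h => .rel _ _ (.inr h)

/-- If `α ≰ φ`, a chain of `φ`- and `α`-steps joins `p` to `q`. The map `z ↦ (z ⊔ p) ⊓ q` sends it
into `[p, q]`, inside one `β`-class when `p β q`, so its `α`-steps become steps of `α ∩ β` and hence
of `φ`. -/
theorem Max_subset_Spec : Max L ⊆ Spec L := by
  intro φ hφ
  refine mem_Spec_iff.2 ⟨hφ.1, fun α β H => or_iff_not_imp_left.2 fun hα => ?_⟩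
  have htop : join φ α = ⊤ := by
    by_contra hne
    exact hα ((le_join_right φ α).trans (hφ.2 hne (le_join_left φ α)))
  refine le_of_forall_le fun p q hpq hr => ?_
  have hβ : ∀ z, β.r ((z ⊔ p) ⊓ q) p := fun z => by
    have := β.inf_congr_left (z ⊔ p) (β.symm hr)
    rwa [inf_eq_right.2 (le_sup_right : p ≤ z ⊔ p)] at this
  have key : ∀ x y, (join φ α).r x y → φ.r ((x ⊔ p) ⊓ q) ((y ⊔ p) ⊓ q) := by
    intro x y h
    induction h with
    | rel x y h =>
      rcases h with h | h
      · exact φ.inf_congr_right q (φ.sup_congr_right p h)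
      · exact H _ _ (α.inf_congr_right q (α.sup_congr_right p h))
          (β.trans (hβ x) (β.symm (hβ y)))
    | refl => exact φ.refl _
    | symm _ _ _ ih => exact φ.symm ih
    | trans _ _ _ _ _ ih₁ ih₂ => exact φ.trans ih₁ ih₂
  simpa [hpq] using key p q (r_of_eq_top htop p q)

end Inclusions

/-! ### Preimages of congruences and subdirect products. -/

section Comap

variable {K L M : Type*} [Lattice K] [Lattice L] [Lattice M]

/-- The preimage of a congruence under a lattice homomorphism. -/
def comap (f : LatticeHom K L) (θ : LatticeCon L) : LatticeCon K where
  toSetoid := θ.toSetoid.comap f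
  inf {w x y z} h₁ h₂ := by
    change θ.r (f (w ⊓ y)) (f (x ⊓ z))
    rw [map_inf, map_inf]
    exact θ.inf h₁ h₂
  sup {w x y z} h₁ h₂ := by
    change θ.r (f (w ⊔ y)) (f (x ⊔ z))
    rw [map_sup, map_sup]
    exact θ.sup h₁ h₂

variable {f : LatticeHom K L}

theorem comap_le_comap_iff (hf : Function.Surjective f) {θ ψ : LatticeCon L} :
    comap f θ ≤ comap f ψ ↔ θ ≤ ψ := by
  refine ⟨fun h x y hxy => ?_, fun h x y hxy => h hxy⟩
  obtain ⟨x, rfl⟩ := hf x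
  obtain ⟨y, rfl⟩ := hf y
  exact h hxy

theorem comap_ne_top_iff (hf : Function.Surjective f) {θ : LatticeCon L} :
    comap f θ ≠ ⊤ ↔ θ ≠ ⊤ := by
  rw [ne_top_iff, ne_top_iff, hf.exists₂]
  rfl

theorem exists_eq_comap (hf : Function.Surjective f) {ψ : LatticeCon K}
    (h : ∀ x y, f x = f y → ψ.r x y) : ∃ θ, ψ = comap f θ := by
  let s := Function.surjInv hf
  have hs : ∀ x, f (s x) = x := Function.surjInv_eq hf
  refine ⟨{ toSetoid := ψ.toSetoid.comap s, inf := ?_, sup := ?_ }, ?_⟩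
  · intro w x y z h₁ h₂
    exact ψ.trans (h _ (s w ⊓ s y) (by simp [hs]))
      (ψ.trans (ψ.inf h₁ h₂) (h (s x ⊓ s z) _ (by simp [hs])))
  · intro w x y z h₁ h₂
    exact ψ.trans (h _ (s w ⊔ s y) (by simp [hs]))
      (ψ.trans (ψ.sup h₁ h₂) (h (s x ⊔ s z) _ (by simp [hs])))
  · refine le_antisymm (fun x y hxy => ?_) fun x y hxy => ?_
    · exact ψ.trans (h _ x (hs _)) (ψ.trans hxy (h y _ (hs _).symm))
    · exact ψ.trans (h x _ (hs _).symm) (ψ.trans hxy (h _ y (hs _)))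

theorem mem_Spec_of_comap (hf : Function.Surjective f) {θ : LatticeCon L}
    (h : comap f θ ∈ Spec K) : θ ∈ Spec L := by
  rw [mem_Spec_iff] at h ⊢
  refine ⟨(comap_ne_top_iff hf).1 h.1, fun α β H => ?_⟩
  exact (h.2 (comap f α) (comap f β) fun x y h₁ h₂ => H _ _ h₁ h₂).imp
    (comap_le_comap_iff hf).1 (comap_le_comap_iff hf).1

theorem comap_mem_Max_iff (hf : Function.Surjective f) {θ : LatticeCon L} :
    comap f θ ∈ Max K ↔ θ ∈ Max L := by
  refine and_congr (comap_ne_top_iff hf) ⟨fun h ψ hψ hle => ?_, fun h ψ hψ hle => ?_⟩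
  · exact (comap_le_comap_iff hf).1
      (h ((comap_ne_top_iff hf).2 hψ) ((comap_le_comap_iff hf).2 hle))
  · obtain ⟨ψ, rfl⟩ := exists_eq_comap hf (ψ := ψ) fun x y hxy =>
      hle (show θ.r (f x) (f y) from hxy ▸ θ.refl _)
    exact (comap_le_comap_iff hf).2
      (h ((comap_ne_top_iff hf).1 hψ) ((comap_le_comap_iff hf).1 hle))

theorem comap_mem_Con₂ (hf : Function.Surjective f) {θ : LatticeCon L} (h : θ ∈ Con₂ L) :
    comap f θ ∈ Con₂ K := by
  obtain ⟨a, b, hab, h⟩ := mem_Con₂_iff.1 h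
  obtain ⟨a, rfl⟩ := hf a
  obtain ⟨b, rfl⟩ := hf b
  exact mem_Con₂_iff.2 ⟨a, b, hab, fun x => h (f x)⟩

/-- A prime congruence of a subdirect product of two lattices is induced by one of the factors. -/
theorem exists_eq_comap_of_mem_Spec {g : LatticeHom K M} (hf : Function.Surjective f)
    (hg : Function.Surjective g) (hfg : ∀ x y, f x = f y → g x = g y → x = y)
    {φ : LatticeCon K} (hφ : φ ∈ Spec K) :
    (∃ θ ∈ Spec L, φ = comap f θ) ∨ ∃ θ ∈ Spec M, φ = comap g θ := by
  refine ((mem_Spec_iff.1 hφ).2 (ker f) (ker g) fun x y h₁ h₂ => ?_).imp (fun h => ?_) fun h => ?_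
  · exact hfg x y h₁ h₂ ▸ φ.refl x
  · obtain ⟨θ, rfl⟩ := exists_eq_comap hf fun x y hxy => h hxy
    exact ⟨θ, mem_Spec_of_comap hf hφ, rfl⟩
  · obtain ⟨θ, rfl⟩ := exists_eq_comap hg fun x y hxy => h hxy
    exact ⟨θ, mem_Spec_of_comap hg hφ, rfl⟩

theorem Spec_subset_Con₂_of_subdirect {g : LatticeHom K M} (hf : Function.Surjective f)
    (hg : Function.Surjective g) (hfg : ∀ x y, f x = f y → g x = g y → x = y)
    (hL : Spec L ⊆ Con₂ L) (hM : Spec M ⊆ Con₂ M) : Spec K ⊆ Con₂ K := by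
  intro φ hφ
  rcases exists_eq_comap_of_mem_Spec hf hg hfg hφ with ⟨θ, hθ, rfl⟩ | ⟨θ, hθ, rfl⟩
  exacts [comap_mem_Con₂ hf (hL hθ), comap_mem_Con₂ hg (hM hθ)]

theorem Spec_subset_Max_of_subdirect {g : LatticeHom K M} (hf : Function.Surjective f)
    (hg : Function.Surjective g) (hfg : ∀ x y, f x = f y → g x = g y → x = y)
    (hL : Spec L ⊆ Max L) (hM : Spec M ⊆ Max M) : Spec K ⊆ Max K := by
  intro φ hφ
  rcases exists_eq_comap_of_mem_Spec hf hg hfg hφ with ⟨θ, hθ, rfl⟩ | ⟨θ, hθ, rfl⟩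
  exacts [(comap_mem_Max_iff hf).2 (hL hθ), (comap_mem_Max_iff hg).2 (hM hθ)]

theorem Max_subset_Con₂_of_subdirect {g : LatticeHom K M} (hf : Function.Surjective f)
    (hg : Function.Surjective g) (hfg : ∀ x y, f x = f y → g x = g y → x = y)
    (hL : Max L ⊆ Con₂ L) (hM : Max M ⊆ Con₂ M) : Max K ⊆ Con₂ K := by
  intro φ hφ
  rcases exists_eq_comap_of_mem_Spec hf hg hfg (Max_subset_Spec hφ) with
    ⟨θ, -, rfl⟩ | ⟨θ, -, rfl⟩
  exacts [comap_mem_Con₂ hf (hL ((comap_mem_Max_iff hf).1 hφ)),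
    comap_mem_Con₂ hg (hM ((comap_mem_Max_iff hg).1 hφ))]

end Comap

/-! ### Distributive lattices and chains. -/

section Distributive

variable {L : Type*} [Lattice L]

theorem Spec_subset_Con₂_of_distrib (hd : ∀ x y z : L, x ⊓ (y ⊔ z) = (x ⊓ y) ⊔ (x ⊓ z)) :
    Spec L ⊆ Con₂ L := by
  intro φ hφ
  obtain ⟨hne, hp⟩ := mem_Spec_iff.1 hφ
  let : DistribLattice L := .ofInfSupLe fun a b c => (hd a b c).le
  -- By distributivity, an element is determined modulo `φ` by its meet and its join with `a`.
  -- Primality puts one of the two induced congruences below `φ`, making `a` the top or the bottom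
  -- of the quotient.
  have key : ∀ a, (∀ x, φ.r (x ⊔ a) a) ∨ ∀ x, φ.r (x ⊓ a) a := by
    intro a
    let fi : LatticeHom L L :=
      { toFun := fun x => x ⊓ a
        map_sup' := fun x y => inf_sup_right x y a
        map_inf' := fun x y => inf_inf_distrib_right x y a }
    let fs : LatticeHom L L :=
      { toFun := fun x => x ⊔ a
        map_sup' := fun x y => sup_sup_distrib_right x y a
        map_inf' := fun x y => sup_inf_right x y a }
    have H : ∀ x y, (comap fi φ).r x y → (comap fs φ).r x y → φ.r x y := by
      intro x y (h₁ : φ.r (x ⊓ a) (y ⊓ a)) (h₂ : φ.r (x ⊔ a) (y ⊔ a))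
      have e₁ : φ.r x ((x ⊓ y) ⊔ (x ⊓ a)) := by
        simpa [inf_sup_left] using φ.inf_congr_left x h₂
      have e₂ : φ.r ((x ⊓ y) ⊔ (y ⊓ a)) y := by
        simpa [inf_sup_left, inf_comm y x] using φ.inf_congr_left y h₂
      exact φ.trans e₁ (φ.trans (φ.sup_congr_left (x ⊓ y) h₁) e₂)
    refine (hp _ _ H).imp (fun h x => h ?_) fun h x => h ?_
    · change φ.r ((x ⊔ a) ⊓ a) (a ⊓ a)
      simp
    · change φ.r ((x ⊓ a) ⊔ a) (a ⊔ a)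
      simp
  have htop : ∀ {a b}, (∀ x, φ.r (x ⊔ a) a) → (∀ x, φ.r (x ⊔ b) b) → φ.r a b := fun {a b} ha hb =>
    φ.trans (φ.symm (ha b)) (sup_comm b a ▸ hb a)
  have hbot : ∀ {a b}, (∀ x, φ.r (x ⊓ a) a) → (∀ x, φ.r (x ⊓ b) b) → φ.r a b := fun {a b} ha hb =>
    φ.trans (φ.symm (ha b)) (inf_comm b a ▸ hb a)
  obtain ⟨x, y, hxy⟩ := ne_top_iff.1 hne
  refine mem_Con₂_iff.2 ⟨x, y, hxy, fun z => ?_⟩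
  rcases key x with hx | hx <;> rcases key y with hy | hy <;> rcases key z with hz | hz
  · exact .inl (htop hz hx)
  · exact absurd (htop hx hy) hxy
  · exact .inl (htop hz hx)
  · exact .inr (hbot hz hy)
  · exact .inr (htop hz hy)
  · exact .inl (hbot hz hx)
  · exact absurd (hbot hx hy) hxy
  · exact .inl (hbot hz hx)

theorem _root_.IsChainLattice.inf_sup_distrib (h : IsChainLattice L) (x y z : L) :
    x ⊓ (y ⊔ z) = (x ⊓ y) ⊔ (x ⊓ z) := by
  rcases h.2 y z with hyz | hyz
  · rw [sup_eq_right.2 hyz, sup_eq_right.2 (inf_le_inf_left x hyz)]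
  · rw [sup_eq_left.2 hyz, sup_eq_left.2 (inf_le_inf_left x hyz)]

end Distributive

/-! ### Intervals on which one congruence lies inside another. -/

section TrivialOn

variable {L : Type*} [Lattice L] {φ θ : LatticeCon L} {x y z t : L}

/-- On the interval `[x, y]`, the congruence `θ` is contained in `φ`. -/
def TrivialOn (φ θ : LatticeCon L) (x y : L) : Prop :=
  ∀ ⦃u v : L⦄, x ≤ u → u ≤ v → v ≤ y → θ.r u v → φ.r u v

/-- If the intervals on which `θ` is contained in `φ` define a congruence, then it lies below the
prime congruence `φ`. -/
theorem TrivialOn.r_of_mem_Spec (hφ : φ ∈ Spec L) (hθ : ¬ θ ≤ φ)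
    (htrans : ∀ ⦃x y z : L⦄, x ≤ y → y ≤ z → TrivialOn φ θ x y → TrivialOn φ θ y z →
      TrivialOn φ θ x z)
    (hinf : ∀ ⦃x y : L⦄ (t : L), x ≤ y → TrivialOn φ θ x y → TrivialOn φ θ (x ⊓ t) (y ⊓ t))
    (hsup : ∀ ⦃x y : L⦄ (t : L), x ≤ y → TrivialOn φ θ x y → TrivialOn φ θ (x ⊔ t) (y ⊔ t))
    (hxy : x ≤ y) (h : TrivialOn φ θ x y) : φ.r x y := by
  have : Std.Refl fun x y : L => TrivialOn φ θ (x ⊓ y) (x ⊔ y) := ⟨fun x u v h₁ h₂ h₃ _ => by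
    rw [le_antisymm h₂ (h₃.trans (by simpa using h₁))]⟩
  have mono : ∀ {x y : L}, x ≤ y → (TrivialOn φ θ (x ⊓ y) (x ⊔ y) ↔ TrivialOn φ θ x y) :=
    fun {x y} h => by rw [inf_eq_left.2 h, sup_eq_right.2 h]
  let τ : LatticeCon L := mk' (fun x y => TrivialOn φ θ (x ⊓ y) (x ⊔ y))
    (fun x y => (mono inf_le_sup).symm)
    (fun x y z h₁ h₂ h₃ h₄ => (mono (h₁.trans h₂)).2
      (htrans h₁ h₂ ((mono h₁).1 h₃) ((mono h₂).1 h₄)))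
    (fun x y t h₁ h₂ => ⟨(mono (inf_le_inf_right t h₁)).2 (hinf t h₁ ((mono h₁).1 h₂)),
      (mono (sup_le_sup_right h₁ t)).2 (hsup t h₁ ((mono h₁).1 h₂))⟩)
  have hτ : τ ≤ φ := ((mem_Spec_iff.1 hφ).2 τ θ fun x y h₁ h₂ =>
    φ.r_inf_sup_iff.1 (h₁ le_rfl inf_le_sup le_rfl (θ.r_inf_sup_iff.2 h₂))).resolve_right hθ
  exact hτ ((mono hxy).2 h)

/-- The ascending chain condition gives a maximal element `c` of the `θ`-class of `a` below `b`. -/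
theorem exists_last_related [WellFoundedGT L] (θ : LatticeCon L) {a b : L} (hab : a ≤ b)
    (h : ¬ θ.r a b) : ∃ c, c < b ∧ ¬ θ.r c b ∧ ∀ w, c < w → w ≤ b → ¬ θ.r c w := by
  obtain ⟨c, ⟨hcb, hac⟩, hmax⟩ := wellFounded_gt.has_min {c : L | c ≤ b ∧ θ.r a c}
    ⟨a, hab, θ.refl a⟩
  have hcb' : ¬ θ.r c b := fun hr => h (θ.trans hac hr)
  exact ⟨c, lt_of_le_of_ne hcb fun e => hcb' (e ▸ θ.refl c), hcb',
    fun w hcw hwb hr => hmax w ⟨hwb, θ.trans hac hr⟩ hcw⟩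

/-- If `φ < θ < ⊤`, the endpoints of an interval with `θ` trivial over `φ` are `φ`-related, hence
`θ`-related; `hex` supplies an interval violating this. -/
theorem mem_Max_of_exists_trivialOn (hφ : φ ∈ Spec L)
    (htrans : ∀ θ : LatticeCon L, ∀ ⦃x y z : L⦄, x ≤ y → y ≤ z → TrivialOn φ θ x y →
      TrivialOn φ θ y z → TrivialOn φ θ x z)
    (hinf : ∀ θ : LatticeCon L, ∀ ⦃x y : L⦄ (t : L), x ≤ y → TrivialOn φ θ x y →
      TrivialOn φ θ (x ⊓ t) (y ⊓ t))
    (hsup : ∀ θ : LatticeCon L, ∀ ⦃x y : L⦄ (t : L), x ≤ y → TrivialOn φ θ x y →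
      TrivialOn φ θ (x ⊔ t) (y ⊔ t))
    (hex : ∀ θ : LatticeCon L, ∀ a b : L, a ≤ b → ¬ θ.r a b →
      ∃ c d, c ≤ d ∧ TrivialOn φ θ c d ∧ ¬ θ.r c d) : φ ∈ Max L := by
  refine ⟨hφ.1, fun θ hθ hle => ?_⟩
  by_contra hn
  obtain ⟨x, y, hxy⟩ := ne_top_iff.1 hθ
  obtain ⟨c, d, hcd, htriv, hr⟩ := hex θ (x ⊓ y) (x ⊔ y) inf_le_sup
    fun h => hxy (θ.r_inf_sup_iff.1 h)
  exact hr (hle (htriv.r_of_mem_Spec hφ hn (htrans θ) (hinf θ) (hsup θ) hcd))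

end TrivialOn

/-! ### Modular lattices. -/

section Modular

variable {L : Type*} [Lattice L] [IsModularLattice L] {φ θ : LatticeCon L} {x y z : L}

theorem TrivialOn.trans_of_modular (hxy : x ≤ y) (hyz : y ≤ z) (h₁ : TrivialOn φ θ x y)
    (h₂ : TrivialOn φ θ y z) : TrivialOn φ θ x z := by
  intro u v hxu huv hvz hr
  have e₁ : φ.r (u ⊓ y) (v ⊓ y) := h₁ (le_inf hxu hxy) (inf_le_inf_right y huv) inf_le_right
    (θ.inf_congr_right y hr)
  have e₂ : φ.r (u ⊔ y) (v ⊔ y) := h₂ le_sup_right (sup_le_sup_right huv y) (sup_le hvz hyz)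
    (θ.sup_congr_right y hr)
  have e₃ := φ.inf_congr_right v e₂
  have e₄ := φ.sup_congr_left u e₁
  rw [sup_inf_assoc_of_le y huv, inf_eq_right.2 (le_sup_left : v ≤ v ⊔ y), inf_comm y v] at e₃
  rw [sup_inf_self] at e₄
  exact φ.trans e₄ e₃

/-- By modularity `w ∈ [x ⊔ t, y ⊔ t]` is recovered from its projection `y ⊓ w ∈ [x, y]`. -/
theorem TrivialOn.sup_of_modular (t : L) (hxy : x ≤ y) (h : TrivialOn φ θ x y) :
    TrivialOn φ θ (x ⊔ t) (y ⊔ t) := by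
  intro u v hu huv hv hr
  have key : ∀ w, x ⊔ t ≤ w → w ≤ y ⊔ t → (x ⊔ t) ⊔ y ⊓ w = w := fun w h₁ h₂ => by
    rw [← sup_inf_assoc_of_le y h₁]
    exact inf_eq_right.2 (h₂.trans (sup_le le_sup_right (le_sup_right.trans le_sup_left)))
  rw [← key u hu (huv.trans hv), ← key v (hu.trans huv) hv]
  exact φ.sup_congr_left _ (h (le_inf hxy (le_sup_left.trans hu)) (inf_le_inf_left y huv)
    inf_le_left (θ.inf_congr_left y hr))

theorem TrivialOn.inf_of_modular (t : L) (hxy : x ≤ y) (h : TrivialOn φ θ x y) :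
    TrivialOn φ θ (x ⊓ t) (y ⊓ t) := by
  intro u v hu huv hv hr
  have key : ∀ w, x ⊓ t ≤ w → w ≤ y ⊓ t → (y ⊓ t) ⊓ (x ⊔ w) = w := fun w h₁ h₂ => by
    rw [← inf_sup_assoc_of_le x h₂]
    exact sup_eq_right.2 ((le_inf inf_le_right (inf_le_left.trans inf_le_right)).trans h₁)
  rw [← key u hu (huv.trans hv), ← key v (hu.trans huv) hv]
  exact φ.inf_congr_left _ (h le_sup_left (sup_le_sup_left huv x)
    (sup_le hxy (hv.trans inf_le_left)) (θ.sup_congr_left x hr))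

theorem Spec_subset_Max_of_modular [WellFoundedGT L] [IsStronglyAtomic L] : Spec L ⊆ Max L := by
  intro φ hφ
  refine mem_Max_of_exists_trivialOn hφ (fun θ _ _ _ => TrivialOn.trans_of_modular)
    (fun θ _ _ => TrivialOn.inf_of_modular) (fun θ _ _ => TrivialOn.sup_of_modular)
    fun θ a b hab hr => ?_
  obtain ⟨c, hcb, -, hlast⟩ := exists_last_related θ hab hr
  obtain ⟨d, hcd, hdb⟩ := exists_covBy_le_of_lt hcb
  -- A covering pair has no proper subinterval, so `θ` is trivial on it once its endpoints are
  -- unrelated.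
  refine ⟨c, d, hcd.le, fun u v hcu huv hvd huv' => ?_, hlast d hcd.lt hdb⟩
  rcases hcd.eq_or_eq hcu (huv.trans hvd) with rfl | rfl
  · rcases huv.eq_or_lt with rfl | hlt
    · exact φ.refl _
    · exact absurd huv' (hlast v hlt (hvd.trans hdb))
  · rw [le_antisymm huv hvd]

end Modular

/-! ### Relatively complemented lattices. -/

section RelativelyComplemented

variable {L : Type*} [Lattice L] {φ θ : LatticeCon L} {x y z : L}

/-- A complement of `u` in `[x, v]` moves the pair `u, v` to a pair at the bottom `x`, and joining
with `u` moves it back. -/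
theorem TrivialOn.of_bot (hc : ∀ a b x : L, a ≤ x → x ≤ b → ∃ y : L, x ⊓ y = a ∧ x ⊔ y = b)
    (h : ∀ w, x ≤ w → w ≤ z → θ.r w x → φ.r w x) : TrivialOn φ θ x z := by
  intro u v hxu huv hvz hr
  obtain ⟨w, rfl, rfl⟩ := hc x v u hxu huv
  have e : θ.r (u ⊓ w) w := by simpa using θ.inf_congr_right w hr
  simpa using φ.sup_congr_left u (φ.symm (h w inf_le_right (le_sup_right.trans hvz) (θ.symm e)))

theorem TrivialOn.of_top (hc : ∀ a b x : L, a ≤ x → x ≤ b → ∃ y : L, x ⊓ y = a ∧ x ⊔ y = b)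
    (h : ∀ w, x ≤ w → w ≤ z → θ.r w z → φ.r w z) : TrivialOn φ θ x z := by
  intro u v hxu huv hvz hr
  obtain ⟨w, rfl, rfl⟩ := hc u z v huv hvz
  have e : θ.r w (v ⊔ w) := by simpa using θ.sup_congr_right w hr
  simpa using φ.inf_congr_left v (h w (hxu.trans inf_le_right) le_sup_right e)

theorem TrivialOn.trans_of_relCompl
    (hc : ∀ a b x : L, a ≤ x → x ≤ b → ∃ y : L, x ⊓ y = a ∧ x ⊔ y = b)
    (hxy : x ≤ y) (hyz : y ≤ z) (h₁ : TrivialOn φ θ x y)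
    (h₂ : TrivialOn φ θ y z) : TrivialOn φ θ x z := by
  refine .of_bot hc fun w hxw hwz hr => ?_
  have e₁ : φ.r x (w ⊓ y) := h₁ le_rfl (le_inf hxw hxy) inf_le_right
    (by simpa [hxy] using θ.inf_congr_right y (θ.symm hr))
  have e₂ : φ.r y (w ⊔ y) := h₂ le_rfl le_sup_right (sup_le hwz hyz)
    (by simpa [hxy] using θ.sup_congr_right y (θ.symm hr))
  have e₃ : φ.r (w ⊓ y) w := by simpa using φ.inf_congr_left w e₂
  exact φ.symm (φ.trans e₁ e₃)

theorem TrivialOn.sup_of_relCompl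
    (hc : ∀ a b x : L, a ≤ x → x ≤ b → ∃ y : L, x ⊓ y = a ∧ x ⊔ y = b)
    (t : L) (hxy : x ≤ y) (h : TrivialOn φ θ x y) : TrivialOn φ θ (x ⊔ t) (y ⊔ t) := by
  refine .of_bot hc fun u hu hu' hr => ?_
  -- The complement turns a pair at the bottom of `[x ⊔ t, y ⊔ t]` into one at its top, which
  -- meeting with `y` carries to a pair at the top of `[x, y]`.
  obtain ⟨v, hv, hv'⟩ := hc _ _ u hu hu'
  have hev : x ⊔ t ≤ v := hv ▸ inf_le_right
  have hvy : v ≤ y ⊔ t := hv' ▸ le_sup_right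
  have e₁ : θ.r (y ⊔ t) v := by simpa [hv', hev] using θ.sup_congr_right v hr
  have e₂ : φ.r (v ⊓ y) y := h (le_inf (le_sup_left.trans hev) hxy) inf_le_right le_rfl
    (by simpa using θ.inf_congr_right y (θ.symm e₁))
  have e₃ : φ.r v (y ⊔ t) := by
    have := φ.sup_congr_left v e₂
    rwa [sup_inf_self, show v ⊔ y = y ⊔ t from le_antisymm (sup_le hvy le_sup_left)
      (sup_le le_sup_right ((le_sup_right.trans hev).trans le_sup_left))] at this
  simpa [hv, hu'] using φ.inf_congr_left u (φ.symm e₃)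

theorem TrivialOn.inf_of_relCompl
    (hc : ∀ a b x : L, a ≤ x → x ≤ b → ∃ y : L, x ⊓ y = a ∧ x ⊔ y = b)
    (t : L) (hxy : x ≤ y) (h : TrivialOn φ θ x y) : TrivialOn φ θ (x ⊓ t) (y ⊓ t) := by
  refine .of_top hc fun u hu hu' hr => ?_
  obtain ⟨v, hv, hv'⟩ := hc _ _ u hu hu'
  have hve : v ≤ y ⊓ t := hv' ▸ le_sup_right
  have hxv : x ⊓ t ≤ v := hv ▸ inf_le_right
  have e₁ : θ.r (x ⊓ t) v := by
    have := θ.inf_congr_right v hr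
    rwa [hv, inf_eq_right.2 hve] at this
  have e₂ : φ.r x (v ⊔ x) := h le_rfl le_sup_right (sup_le (hve.trans inf_le_left) hxy)
    (by simpa using θ.sup_congr_right x e₁)
  have e₃ : φ.r (x ⊓ t) v := by
    have := φ.inf_congr_left v e₂
    rwa [inf_sup_self, show v ⊓ x = x ⊓ t from le_antisymm
      (le_inf inf_le_right (inf_le_left.trans (hve.trans inf_le_right)))
      (le_inf hxv inf_le_left)] at this
  have := φ.sup_congr_left u e₃
  rwa [sup_eq_left.2 hu, hv'] at this

theorem Spec_subset_Max_of_relCompl [WellFoundedGT L]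
    (hc : ∀ a b x : L, a ≤ x → x ≤ b → ∃ y : L, x ⊓ y = a ∧ x ⊔ y = b) : Spec L ⊆ Max L := by
  intro φ hφ
  refine mem_Max_of_exists_trivialOn hφ (fun θ _ _ _ => TrivialOn.trans_of_relCompl hc)
    (fun θ _ _ => TrivialOn.inf_of_relCompl hc) (fun θ _ _ => TrivialOn.sup_of_relCompl hc)
    fun θ a b hab hr => ?_
  obtain ⟨c, hcb, hcb', hlast⟩ := exists_last_related θ hab hr
  refine ⟨c, b, hcb.le, .of_bot hc fun w hcw hwb hw => ?_, hcb'⟩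
  rcases hcw.eq_or_lt with rfl | hlt
  · exact φ.refl _
  · exact absurd (θ.symm hw) (hlast w hlt hwb)

end RelativelyComplemented

end LatticeCon

/-! ### The pentagon, with `a = (0, 1)`, `b = (0, 2)`, `c = (1, 0)`. -/

namespace PentagonOrder

/-- The lattice structure of the pentagon. -/
abbrev lattice : Lattice PentagonOrder :=
  { (inferInstance : PartialOrder PentagonOrder) with
    sup := fun p q => if h : p.1 ⊔ q.1 ≠ (1, 1) then ⟨p.1 ⊔ q.1, h⟩ else ⟨(1, 2), by decide⟩
    -- The default is never reached: a componentwise meet of two pentagon elements is never `(1,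
    -- 1)`.
    inf := fun p q => if h : p.1 ⊓ q.1 ≠ (1, 1) then ⟨p.1 ⊓ q.1, h⟩ else ⟨(1, 0), by decide⟩
    le_sup_left := by decide
    le_sup_right := by decide
    sup_le := by decide
    inf_le_left := by decide
    inf_le_right := by decide
    le_inf := by decide }

attribute [local instance] lattice

/-- The homomorphism onto the two-element chain with classes `{0, a, b}` and `{c, 1}`. -/
def homFst : LatticeHom PentagonOrder Bool where
  toFun p := p.1.1 = 1
  map_sup' := by decide
  map_inf' := by decide

/-- The homomorphism onto the two-element chain with classes `{0, c}` and `{a, b, 1}`. -/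
def homSnd : LatticeHom PentagonOrder Bool where
  toFun p := p.1.2 ≠ 0
  map_sup' := by decide
  map_inf' := by decide

theorem eq_or_eq_of_hom_eq : ∀ x y : PentagonOrder, homFst x = homFst y → homSnd x = homSnd y →
    x ≤ y → x = y ∨ (x = ⟨(0, 1), by decide⟩ ∧ y = ⟨(0, 2), by decide⟩) := by
  decide

/-- A unary polynomial with values in `{a, b}` on suitable arguments. -/
def polynomial (s t x : PentagonOrder) : PentagonOrder :=
  (((x ⊓ s) ⊔ t) ⊓ ⟨(0, 2), by decide⟩) ⊔ ⟨(0, 1), by decide⟩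

set_option synthInstance.maxSize 1000 in
set_option synthInstance.maxHeartbeats 200000 in
-- Polynomials preserve congruences, so every congruence other than equality relates `a` and `b`.
theorem exists_polynomial : ∀ x y : PentagonOrder, x ≤ y → x ≠ y → ∃ s t : PentagonOrder,
    polynomial s t x = ⟨(0, 1), by decide⟩ ∧ polynomial s t y = ⟨(0, 2), by decide⟩ := by
  decide

open LatticeCon in
theorem Max_subset_Con₂ : LatticeCon.Max PentagonOrder ⊆ Con₂ PentagonOrder := by
  intro φ hφ
  have hker : ∀ f : LatticeHom PentagonOrder Bool, (∃ a b, f a ≠ f b) →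
      ker f ∈ Con₂ PentagonOrder := by
    rintro f ⟨a, b, hab⟩
    refine mem_Con₂_iff.2 ⟨a, b, hab, fun x => ?_⟩
    change f x = f a ∨ f x = f b
    revert hab
    generalize f x = p, f a = q, f b = r
    revert p q r
    decide
  have hfst : ker homFst ∈ Con₂ PentagonOrder := hker _ (by decide)
  have hsnd : ker homSnd ∈ Con₂ PentagonOrder := hker _ (by decide)
  have hab : φ.r ⟨(0, 1), by decide⟩ ⟨(0, 2), by decide⟩ := by
    obtain ⟨x, y, hxy, hne, hr⟩ : ∃ x y, x ≤ y ∧ x ≠ y ∧ φ.r x y := by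
      by_contra! hn
      -- Were `φ` equality, it would lie below `ker homFst`; maximality would force the reverse
      -- inclusion, although `ker homFst` relates `a` and `b`.
      have hle : φ ≤ ker homFst := le_of_forall_le fun x y hxy hr => by
        by_cases he : x = y
        · exact he ▸ (ker homFst).refl x
        · exact absurd hr (hn x y hxy he)
      have h := hφ.2 (Con₂_subset_Max hfst).1 hle
      exact hn ⟨(0, 1), by decide⟩ ⟨(0, 2), by decide⟩ (by decide) (by decide)
        (h (show homFst _ = homFst _ by decide))
    obtain ⟨s, t, h₁, h₂⟩ := exists_polynomial x y hxy hne
    have := φ.sup_congr_right ⟨(0, 1), by decide⟩ (φ.inf_congr_right ⟨(0, 2), by decide⟩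
      (φ.sup_congr_right t (φ.inf_congr_right s hr)))
    rw [← h₁, ← h₂]
    exact this
  have heq : ∀ ψ ∈ Con₂ PentagonOrder, ψ ≤ φ → φ ∈ Con₂ PentagonOrder := fun ψ hψ hle =>
    le_antisymm hle ((Con₂_subset_Max hψ).2 hφ.1 hle) ▸ hψ
  -- The two kernels together separate all comparable pairs except `a < b`, so primality puts one of
  -- these maximal kernels below `φ`.
  have hinter : ∀ x y, (inter (ker homFst) (ker homSnd)).r x y → φ.r x y :=
    le_of_forall_le fun x y hxy h => by
      rcases eq_or_eq_of_hom_eq x y h.1 h.2 hxy with rfl | ⟨rfl, rfl⟩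
      exacts [φ.refl _, hab]
  exact ((mem_Spec_iff.1 (Max_subset_Spec hφ)).2 _ _ fun x y h₁ h₂ => hinter x y ⟨h₁, h₂⟩).elim
    (heq _ hfst) (heq _ hsnd)

end PentagonOrder

theorem IsPentagon.Max_subset_Con₂ {L : Type*} [Lattice L] (h : IsPentagon L) :
    LatticeCon.Max L ⊆ LatticeCon.Con₂ L := by
  obtain ⟨e⟩ := h
  let := PentagonOrder.lattice
  let f : LatticeHom L PentagonOrder :=
    { toFun := e, map_sup' := e.map_sup, map_inf' := e.map_inf }
  exact LatticeCon.Max_subset_Con₂_of_subdirect (f := f) (g := f) e.surjective e.surjective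
    (fun x y hxy _ => e.injective hxy) PentagonOrder.Max_subset_Con₂ PentagonOrder.Max_subset_Con₂

/-! ### Induction over the construction, and the proposition. -/

/-- A property of lattices that is inherited by subdirect products of two lattices is inherited by
the lattices obtained through finite direct products and finite ordinal sums. -/
theorem ObtainedFrom.of_subdirect {P Q : ∀ (L : Type u) [Lattice L], Prop}
    (hPQ : ∀ (L : Type u) [Lattice L], P L → Nonempty L ∧ Q L)
    (hQ : ∀ (K L M : Type u) [Lattice K] [Lattice L] [Lattice M] (f : LatticeHom K L)
      (g : LatticeHom K M), Function.Surjective f → Function.Surjective g →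
      (∀ x y, f x = f y → g x = g y → x = y) → Q L → Q M → Q K)
    {L : Type u} [Lattice L] (h : ObtainedFrom P L) : Nonempty L ∧ Q L := by
  induction h with
  | block L hL => exact hPQ L hL
  | prod L M _ _ ihL ihM =>
    obtain ⟨⟨a⟩, hL⟩ := ihL
    obtain ⟨⟨b⟩, hM⟩ := ihM
    exact ⟨⟨(a, b)⟩, hQ _ L M
      { toFun := Prod.fst, map_sup' := fun _ _ => rfl, map_inf' := fun _ _ => rfl }
      { toFun := Prod.snd, map_sup' := fun _ _ => rfl, map_inf' := fun _ _ => rfl }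
      (fun x => ⟨(x, b), rfl⟩) (fun y => ⟨(a, y), rfl⟩) (fun _ _ h₁ h₂ => Prod.ext h₁ h₂) hL hM⟩
  | ordinalSum L M _ _ ihL ihM =>
    exact ⟨⟨⟨(⊤, ⊥), .inl rfl⟩⟩, hQ _ L M
      { toFun := fun p => p.1.1, map_sup' := fun _ _ => rfl, map_inf' := fun _ _ => rfl }
      { toFun := fun p => p.1.2, map_sup' := fun _ _ => rfl, map_inf' := fun _ _ => rfl }
      (fun x => ⟨⟨(x, ⊥), .inr rfl⟩, rfl⟩) (fun y => ⟨⟨(⊤, y), .inl rfl⟩, rfl⟩)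
      (fun _ _ h₁ h₂ => Subtype.ext (Prod.ext h₁ h₂)) ihL.2 ihM.2⟩
  | iso L M e _ ih =>
    -- An isomorphic copy is a subdirect product with both projections equal to the isomorphism.
    exact ⟨ih.1.map e, hQ M L L
      { toFun := e.symm, map_sup' := e.symm.map_sup, map_inf' := e.symm.map_inf }
      { toFun := e.symm, map_sup' := e.symm.map_sup, map_inf' := e.symm.map_inf }
      e.symm.surjective e.symm.surjective (fun x y h _ => e.symm.injective h) ih.2 ih.2⟩

theorem IsBoundedDistributive.nonempty {L : Type*} [Lattice L] (h : IsBoundedDistributive L) :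
    Nonempty L :=
  let ⟨o, _⟩ := h.1
  ⟨o⟩

theorem IsFiniteModular.Spec_subset_Max {L : Type*} [Lattice L] (h : IsFiniteModular L) :
    LatticeCon.Spec L ⊆ LatticeCon.Max L :=
  have := h.2.1
  have := h.2.2
  LatticeCon.Spec_subset_Max_of_modular

theorem IsRelativelyComplementedACC.Spec_subset_Max {L : Type*} [Lattice L]
    (h : IsRelativelyComplementedACC L) : LatticeCon.Spec L ⊆ LatticeCon.Max L :=
  have := h.2.2
  LatticeCon.Spec_subset_Max_of_relCompl h.2.1

open LatticeCon in
theorem IsChainLattice.Spec_subset_Con₂ {L : Type*} [Lattice L] (h : IsChainLattice L) :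
    Spec L ⊆ Con₂ L :=
  Spec_subset_Con₂_of_distrib h.inf_sup_distrib

open LatticeCon in
theorem IsBoundedDistributive.Spec_subset_Con₂ {L : Type*} [Lattice L]
    (h : IsBoundedDistributive L) : Spec L ⊆ Con₂ L :=
  Spec_subset_Con₂_of_distrib h.2.2

theorem proposition6p11 {L : Type*} [Lattice L] :
    (ObtainedFrom (fun K _ => IsChainLattice K ∨ IsBoundedDistributive K) L →
      LatticeCon.Spec L = LatticeCon.Max L ∧ LatticeCon.Max L = LatticeCon.Con₂ L) ∧
    (ObtainedFrom (fun K _ => IsChainLattice K ∨ IsBoundedDistributive K ∨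
        IsFiniteModular K ∨ IsRelativelyComplementedACC K) L →
      LatticeCon.Spec L = LatticeCon.Max L) ∧
    (ObtainedFrom (fun K _ => IsChainLattice K ∨ IsBoundedDistributive K ∨ IsPentagon K) L →
      LatticeCon.Max L = LatticeCon.Con₂ L) := by
  refine ⟨fun h => ?_, fun h => ?_, fun h => ?_⟩
  · have key := (h.of_subdirect (Q := fun K _ => LatticeCon.Spec K ⊆ LatticeCon.Con₂ K)
      (fun K _ hK => ?_)
      fun K L M _ _ _ f g hf hg => LatticeCon.Spec_subset_Con₂_of_subdirect hf hg).2
    · exact ⟨(key.trans LatticeCon.Con₂_subset_Max).antisymm LatticeCon.Max_subset_Spec,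
        (LatticeCon.Max_subset_Spec.trans key).antisymm LatticeCon.Con₂_subset_Max⟩
    · rcases hK with hK | hK
      exacts [⟨hK.1, hK.Spec_subset_Con₂⟩, ⟨hK.nonempty, hK.Spec_subset_Con₂⟩]
  · have key := (h.of_subdirect (Q := fun K _ => LatticeCon.Spec K ⊆ LatticeCon.Max K)
      (fun K _ hK => ?_)
      fun K L M _ _ _ f g hf hg => LatticeCon.Spec_subset_Max_of_subdirect hf hg).2
    · exact key.antisymm LatticeCon.Max_subset_Spec
    · rcases hK with hK | hK | hK | hK
      exacts [⟨hK.1, hK.Spec_subset_Con₂.trans LatticeCon.Con₂_subset_Max⟩,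
        ⟨hK.nonempty, hK.Spec_subset_Con₂.trans LatticeCon.Con₂_subset_Max⟩,
        ⟨hK.1, hK.Spec_subset_Max⟩, ⟨hK.1, hK.Spec_subset_Max⟩]
  · have key := (h.of_subdirect (Q := fun K _ => LatticeCon.Max K ⊆ LatticeCon.Con₂ K)
      (fun K _ hK => ?_)
      fun K L M _ _ _ f g hf hg => LatticeCon.Max_subset_Con₂_of_subdirect hf hg).2
    · exact key.antisymm LatticeCon.Con₂_subset_Max
    · rcases hK with hK | hK | hK
      exacts [⟨hK.1, LatticeCon.Max_subset_Spec.trans hK.Spec_subset_Con₂⟩,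
        ⟨hK.nonempty, LatticeCon.Max_subset_Spec.trans hK.Spec_subset_Con₂⟩,
        ⟨let ⟨e⟩ := hK; ⟨e.symm ⟨(0, 0), by decide⟩⟩, hK.Max_subset_Con₂⟩]
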